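/- Let $K$ be a field, let $a_1,\dots,a_n$ be positive integers with $a_1<a_2$ (if $n\ge 2$), and let $A=(a_1\ \cdots\ a_n)\in\mathbb Z^{1\times n}$. Assume that $A$ is a monomial curve of the first kind, i.e. $A=((\cdots((a_1\circ a_2)\circ a_3)\cdots)\circ a_n)$: for every $2\le k\le n$ there is an $x\in\mathbb N\{a_1,\dots,a_{k-1}\}\cap\mathbb N a_k$ with $x\mathbb Z=\mathbb Z\{a_1,\dots,a_{k-1}\}\cap\mathbb Z a_k$. For $u\in\mathbb Z^n$ write $u=u^+-u^-$ with $u^\pm\in\mathbb N^n$ of disjoint supports. A Markov basis of $A$ is a set $B\subseteq\ker A$ such that $\langle x^{u^+}-x^{u^-}:u\in B\rangle=\langle x^{u^+}-x^{u^-}:u\in\ker A\rangle$ in $K[x_1,\dots,x_n]$; it is minimal if no proper subset is a Markov basis. Let $M$ be a minimal Markov basis of $A$ in triangular form, i.e. up to the signs of its elements $M=\{u_2,\dots,u_n\}$ with $$u_k=(u_{k,1},\dots,u_{k,k-1},-u_{k,k},0,\dots,0),\qquad u_{k,1},\dots,u_{k,k}\in\mathbb N .$$ A move $u$ reduces the distance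 of $z\in\ker A$ if at least one of the following holds, where $\|\cdot\|$ is the $1$-norm: $z^++u\in\mathbb N^n$ and $\|z^++u-z^-\|<\|z^+-z^-\|$; $z^+-u\in\mathbb N^n$ and $\|z^+-u-z^-\|<\|z^+-z^-\|$; $z^-+u\in\mathbb N^n$ and $\|z^+-(z^-+u)\|<\|z^+-z^-\|$; $z^--u\in\mathbb N^n$ and $\|z^+-(z^--u)\|<\|z^+-z^-\|$. The set $M$ reduces the distance of $Z\subseteq\ker A$ if every $z\in Z$ has its distance reduced by some $u\in M$, and $M$ is distance reducing if it reduces the distance of $\ker A\setminus\{0\}$. A circuit of $A$ is an element of $\ker A$ with exactly two nonzero coordinates, these being coprime. For $2\le i<j\le n$, $M$ satisfies $R_{i,j}$ if at least one of the following holds: - (i) $u_{i,1}+\dots+u_{i,i-1}<u_{i,i}$; - (ii) there is an $\ell$ with $i<\ell<j$ such that $u_{\ell,m}=0$ for all $m\in\{1,\dots,\ell-1\}\setminus\{i\}$, and $u_{\ell,i}>u_{\ell,\ell}$; - (iii) $\sum_{k=1}^{j}u_{j,k}<2(u_{j,i}+u_{j,j})$. Then the following are equivalent: 1. $M$ is distance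 reducing; 2. $M$ reduces the distance of the circuits of $A$; 3. $M$ satisfies $R_{i,j}$ for all $2\le i<j\le n$. -/

import Mathlib

/-- The kernel of the `1 × n` matrix `A = (a_1, …, a_n)`, as a set of integer vectors. -/
def kerSet {n : ℕ} (a : Fin n → ℕ) : Set (Fin n → ℤ) :=
  {z | ∑ i, (a i : ℤ) * z i = 0}

/-- The exponent vector of the monomial `x^{u⁺}`. -/
noncomputable def posExp {n : ℕ} (u : Fin n → ℤ) : Fin n →₀ ℕ :=
  Finsupp.equivFunOnFinite.symm fun i => (u i).toNat

/-- The binomial `x^{u⁺} - x^{u⁻}`, where `u⁻ = (-u)⁺`. -/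
noncomputable def binomial (K : Type*) [Field K] {n : ℕ} (u : Fin n → ℤ) :
    MvPolynomial (Fin n) K :=
  MvPolynomial.monomial (posExp u) 1 - MvPolynomial.monomial (posExp (-u)) 1

/-- The toric ideal `I_A`. -/
noncomputable def toricIdeal (K : Type*) [Field K] {n : ℕ} (a : Fin n → ℕ) :
    Ideal (MvPolynomial (Fin n) K) :=
  Ideal.span (binomial K '' kerSet a)

/-- A Markov basis: a subset of `ker A` whose binomials generate the toric ideal. -/
def IsMarkovBasis (K : Type*) [Field K] {n : ℕ} (a : Fin n → ℕ)
    (B : Set (Fin n → ℤ)) : Prop :=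
  B ⊆ kerSet a ∧ Ideal.span (binomial K '' B) = toricIdeal K a

/-- A Markov basis none of whose proper subsets is a Markov basis. -/
def IsMinimalMarkovBasis (K : Type*) [Field K] {n : ℕ} (a : Fin n → ℕ)
    (M : Set (Fin n → ℤ)) : Prop :=
  IsMarkovBasis K a M ∧ ∀ B, B ⊂ M → ¬ IsMarkovBasis K a B

/-- The gluing property for sets of generators `B` and `C`:
some `x ∈ ℕB ∩ ℕC` satisfies `xℤ = ℤB ∩ ℤC`. -/
def IsGluing (B C : Set ℕ) : Prop :=
  ∃ x : ℕ, x ∈ AddSubmonoid.closure B ∧ x ∈ AddSubmonoid.closure C ∧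
    AddSubgroup.zmultiples (x : ℤ) =
      AddSubgroup.closure ((fun b : ℕ => (b : ℤ)) '' B) ⊓
        AddSubgroup.closure ((fun c : ℕ => (c : ℤ)) '' C)

/-- `A = ((…((a_1 ∘ a_2) ∘ a_3)…) ∘ a_n)`: every generator but the first is glued to the
tuple of all generators before it. -/
def IsFirstKind {n : ℕ} (a : Fin n → ℕ) : Prop :=
  ∀ k : Fin n, 0 < k.val → IsGluing {b | ∃ i, i < k ∧ b = a i} {a k}

/-- The distance between integer vectors induced by the `1`-norm. -/
def l1Dist {n : ℕ} (x y : Fin n → ℤ) : ℤ :=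
  ∑ i, |x i - y i|

/-- The move `u` reduces the distance of `z`: adding or subtracting `u` at `z⁺` or at `z⁻` keeps
that point in `ℕ^n` (which is what the applicability conditions `u⁻ ≤ z⁺` etc. say) and brings
`z⁺` and `z⁻` closer in the `1`-norm. -/
def MoveReduces {n : ℕ} (u z : Fin n → ℤ) : Prop :=
  (u⁻ ≤ z⁺ ∧ l1Dist (z⁺ + u) z⁻ < l1Dist z⁺ z⁻) ∨
  (u⁺ ≤ z⁺ ∧ l1Dist (z⁺ - u) z⁻ < l1Dist z⁺ z⁻) ∨
  (u⁻ ≤ z⁻ ∧ l1Dist z⁺ (z⁻ + u) < l1Dist z⁺ z⁻) ∨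
  (u⁺ ≤ z⁻ ∧ l1Dist z⁺ (z⁻ - u) < l1Dist z⁺ z⁻)

/-- `B` reduces the distance of `Z`. -/
def ReducesDistance {n : ℕ} (B Z : Set (Fin n → ℤ)) : Prop :=
  ∀ z ∈ Z, ∃ u ∈ B, MoveReduces u z

/-- `B` is distance reducing for `A`: it reduces the distance of the nonzero elements of `ker A`
(for `z = 0` there is no distance to reduce). -/
def IsDistanceReducing {n : ℕ} (a : Fin n → ℕ) (B : Set (Fin n → ℤ)) : Prop :=
  ReducesDistance B {z | z ∈ kerSet a ∧ z ≠ 0}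

/-- The circuits of `A`: the elements of `ker A` supported on exactly two coordinates, with
coprime entries. -/
def circuits {n : ℕ} (a : Fin n → ℕ) : Set (Fin n → ℤ) :=
  {z | z ∈ kerSet a ∧ (Finset.univ.filter fun i => z i ≠ 0).card = 2 ∧ Finset.univ.gcd z = 1}

/-- The vector `u_k = (u_{k,1}, …, u_{k,k-1}, -u_{k,k}, 0, …, 0)`. -/
def rowMove {n : ℕ} (u : Fin n → Fin n → ℕ) (k : Fin n) : Fin n → ℤ :=
  fun j => if j < k then (u k j : ℤ) else if j = k then -(u k k : ℤ) else 0

/-- `M` is, up to the signs of its elements, the set of rows `u_2, …, u_n`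
(coordinates are numbered from `0` here, so that these are the rows of index `k > 0`). -/
def IsTriangularForm {n : ℕ} (M : Set (Fin n → ℤ)) (u : Fin n → Fin n → ℕ) : Prop :=
  (∀ k : Fin n, 0 < k.val → rowMove u k ∈ M ∨ -rowMove u k ∈ M) ∧
  ∀ v ∈ M, ∃ k : Fin n, 0 < k.val ∧ (v = rowMove u k ∨ v = -rowMove u k)

/-- The condition `R_{i,j}`. -/
def CondR {n : ℕ} (u : Fin n → Fin n → ℕ) (i j : Fin n) : Prop :=
  (∑ k ∈ Finset.Iio i, u i k < u i i) ∨
  (∃ l : Fin n, i < l ∧ l < j ∧ (∀ m : Fin n, m < l → m ≠ i → u l m = 0) ∧ u l l < u l i) ∨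
  (∑ k ∈ Finset.Iic j, u j k < 2 * (u j i + u j j))

open Finset

/-- The `1`-norm of an integer vector. -/
def l1Norm {n : ℕ} (x : Fin n → ℤ) : ℤ := ∑ i, |x i|

lemma moveReduces_iff {n : ℕ} (u z : Fin n → ℤ) :
    MoveReduces u z ↔
      ((u⁻ ≤ z⁺ ∨ u⁺ ≤ z⁻) ∧ l1Norm (z + u) < l1Norm z) ∨
      ((u⁺ ≤ z⁺ ∨ u⁻ ≤ z⁻) ∧ l1Norm (z - u) < l1Norm z) := by
  have hz (i : Fin n) : z⁺ i - z⁻ i = z i := congrFun (posPart_sub_negPart z) i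
  have h0 : l1Dist z⁺ z⁻ = l1Norm z := by simp only [l1Dist, l1Norm, hz]
  have h1 : l1Dist (z⁺ + u) z⁻ = l1Norm (z + u) :=
    sum_congr rfl fun i _ => by rw [Pi.add_apply, Pi.add_apply, ← hz i]; ring_nf
  have h2 : l1Dist (z⁺ - u) z⁻ = l1Norm (z - u) :=
    sum_congr rfl fun i _ => by rw [Pi.sub_apply, Pi.sub_apply, ← hz i]; ring_nf
  have h3 : l1Dist z⁺ (z⁻ + u) = l1Norm (z - u) :=
    sum_congr rfl fun i _ => by rw [Pi.add_apply, Pi.sub_apply, ← hz i]; ring_nf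
  have h4 : l1Dist z⁺ (z⁻ - u) = l1Norm (z + u) :=
    sum_congr rfl fun i _ => by rw [Pi.sub_apply, Pi.add_apply, ← hz i]; ring_nf
  rw [MoveReduces, h0, h1, h2, h3, h4]
  tauto

lemma moveReduces_neg_left {n : ℕ} (u z : Fin n → ℤ) : MoveReduces (-u) z ↔ MoveReduces u z := by
  rw [moveReduces_iff, moveReduces_iff, posPart_neg, negPart_neg, ← sub_eq_add_neg, sub_neg_eq_add]
  tauto

lemma l1Norm_neg {n : ℕ} (x : Fin n → ℤ) : l1Norm (-x) = l1Norm x := by simp [l1Norm]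

lemma moveReduces_neg_right {n : ℕ} (u z : Fin n → ℤ) :
    MoveReduces u (-z) ↔ MoveReduces u z := by
  have h1 : -z + u = -(z - u) := by abel
  have h2 : -z - u = -(z + u) := by abel
  rw [moveReduces_iff, moveReduces_iff, posPart_neg, negPart_neg, h1, h2, l1Norm_neg, l1Norm_neg,
    l1Norm_neg]
  tauto

lemma l1Norm_add_lt {n : ℕ} {z v : Fin n → ℤ} (P : Finset (Fin n))
    (hP : ∀ m ∈ P, |z m + v m| = |z m| - |v m|) (h : ∑ m, |v m| < 2 * ∑ m ∈ P, |v m|) :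
    l1Norm (z + v) < l1Norm z := by
  have h1 : ∑ m ∈ P, |z m + v m| = ∑ m ∈ P, |z m| - ∑ m ∈ P, |v m| := by
    rw [← sum_sub_distrib]; exact sum_congr rfl hP
  have h2 : ∑ m ∈ Pᶜ, |z m + v m| ≤ ∑ m ∈ Pᶜ, |z m| + ∑ m ∈ Pᶜ, |v m| := by
    rw [← sum_add_distrib]; exact sum_le_sum fun m _ => abs_add_le _ _
  have h3 := sum_add_sum_compl P fun m => |z m + v m|
  have h4 := sum_add_sum_compl P fun m => |z m|
  have h5 := sum_add_sum_compl P fun m => |v m|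
  simp only [l1Norm, Pi.add_apply]
  linarith

lemma l1Norm_le_add {n : ℕ} {z v : Fin n → ℤ} (P : Finset (Fin n))
    (hP : ∀ m ∉ P, z m = 0) (h : 2 * ∑ m ∈ P, |v m| ≤ ∑ m, |v m|) :
    l1Norm z ≤ l1Norm (z + v) := by
  have h1 : ∑ m ∈ P, |z m| ≤ ∑ m ∈ P, |z m + v m| + ∑ m ∈ P, |v m| := by
    rw [← sum_add_distrib]
    refine sum_le_sum fun m _ => ?_
    have := abs_sub (z m + v m) (v m)
    rwa [add_sub_cancel_right] at this
  have h2 : ∑ m ∈ Pᶜ, |z m + v m| = ∑ m ∈ Pᶜ, |v m| :=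
    sum_congr rfl fun m hm => by rw [hP m (mem_compl.1 hm), zero_add]
  have h6 : ∑ m ∈ Pᶜ, |z m| = 0 :=
    sum_eq_zero fun m hm => by rw [hP m (mem_compl.1 hm), abs_zero]
  have h3 := sum_add_sum_compl P fun m => |z m + v m|
  have h4 := sum_add_sum_compl P fun m => |z m|
  have h5 := sum_add_sum_compl P fun m => |v m|
  simp only [l1Norm, Pi.add_apply]
  linarith

section Rows

variable {n : ℕ} (u : Fin n → Fin n → ℕ)

lemma rowMove_of_lt {k m : Fin n} (h : m < k) : rowMove u k m = u k m := if_pos h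

lemma rowMove_self (k : Fin n) : rowMove u k k = -(u k k : ℤ) := by simp [rowMove]

lemma rowMove_of_gt {k m : Fin n} (h : k < m) : rowMove u k m = 0 := by
  simp [rowMove, h.not_gt, h.ne']

lemma abs_rowMove (k m : Fin n) : |rowMove u k m| = if m ≤ k then (u k m : ℤ) else 0 := by
  rcases lt_trichotomy m k with h | rfl | h
  · simp [rowMove_of_lt u h, h.le]
  · simp [rowMove_self]
  · simp [rowMove_of_gt u h, h.not_ge]

lemma sum_abs_rowMove (k : Fin n) :
    ∑ m, |rowMove u k m| = ((∑ m ∈ Iic k, u k m : ℕ) : ℤ) := by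
  simp only [abs_rowMove, ← sum_filter]
  push_cast
  exact sum_congr (by ext; simp) fun _ _ => rfl

lemma sum_Iic_eq (k : Fin n) : ∑ m ∈ Iic k, u k m = ∑ m ∈ Iio k, u k m + u k k := by
  rw [← Iio_insert, sum_insert (by simp), add_comm]

lemma negPart_rowMove_le {k : Fin n} {w : Fin n → ℤ} (hw : 0 ≤ w) (h : (u k k : ℤ) ≤ w k) :
    (rowMove u k)⁻ ≤ w := by
  intro m
  rw [Pi.negPart_apply]
  rcases lt_trichotomy m k with hm | rfl | hm
  · rw [rowMove_of_lt u hm, negPart_eq_zero.2 (by positivity)]; exact hw m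
  · rwa [rowMove_self, negPart_neg, posPart_of_nonneg (by positivity)]
  · rw [rowMove_of_gt u hm, negPart_zero]; exact hw m

/-- The row `t` involves, besides `t`, the single column `p`, whose entry is the larger one. -/
def IsChild (t p : Fin n) : Prop :=
  p < t ∧ (∀ m < t, m ≠ p → u t m = 0) ∧ u t t < u t p

variable {u}

lemma IsChild.sum_Iic {t p : Fin n} (h : IsChild u t p) :
    ∑ m ∈ Iic t, u t m = u t p + u t t := by
  rw [sum_Iic_eq, sum_eq_single_of_mem p (by simpa using h.1)]
  intro m hm hmp
  exact h.2.1 m (by simpa using hm) hmp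

lemma IsChild.parent_unique {t p q : Fin n} (hp : IsChild u t p) (hq : IsChild u t q) :
    p = q := by
  by_contra hne
  have h1 := hq.2.1 p hp.1 hne
  have h2 := hp.2.2
  omega

lemma posPart_rowMove_le {t p : Fin n} (h : IsChild u t p) {w : Fin n → ℤ} (hw : 0 ≤ w)
    (hp : (u t p : ℤ) ≤ w p) : (rowMove u t)⁺ ≤ w := by
  intro m
  rw [Pi.posPart_apply]
  rcases lt_trichotomy m t with hm | rfl | hm
  · rw [rowMove_of_lt u hm, posPart_of_nonneg (by positivity)]
    by_cases hmp : m = p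
    · rwa [hmp]
    · rw [h.2.1 m hm hmp]; exact hw m
  · rw [rowMove_self, posPart_neg, negPart_eq_zero.2 (by positivity)]; exact hw m
  · rw [rowMove_of_gt u hm, posPart_zero]; exact hw m

lemma abs_add_of_le_neg {x y : ℤ} (hy : 0 ≤ y) (h : y ≤ -x) : |x + y| = |x| - |y| := by
  rw [abs_of_nonpos (by omega), abs_of_nonpos (by omega : x ≤ 0), abs_of_nonneg hy]; ring

lemma abs_sub_of_le {x y : ℤ} (hy : 0 ≤ y) (h : y ≤ x) : |x + -y| = |x| - |-y| := by
  rw [abs_neg, abs_of_nonneg (by omega), abs_of_nonneg (by omega : 0 ≤ x), abs_of_nonneg hy]; ring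

lemma moveReduces_of_contracting {k : Fin n} {z : Fin n → ℤ}
    (hk : ∑ m ∈ Iio k, u k m < u k k) (hz : (u k k : ℤ) ≤ -z k) :
    MoveReduces (rowMove u k) z := by
  rw [moveReduces_iff]
  refine .inr ⟨.inr (negPart_rowMove_le u (negPart_nonneg z) ?_), ?_⟩
  · rw [Pi.negPart_apply]; exact hz.trans (neg_le_negPart _)
  · rw [sub_eq_add_neg]
    refine l1Norm_add_lt {k} ?_ ?_
    · intro m hm
      rw [mem_singleton.1 hm, Pi.neg_apply, rowMove_self, neg_neg]
      exact abs_add_of_le_neg (by positivity) hz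
    · simp only [Pi.neg_apply, abs_neg, sum_abs_rowMove, sum_singleton, rowMove_self, Nat.abs_cast,
        sum_Iic_eq]
      exact_mod_cast (by omega)

lemma moveReduces_of_isChild {l k : Fin n} {z : Fin n → ℤ} (h : IsChild u l k)
    (hz : (u l k : ℤ) ≤ -z k) : MoveReduces (rowMove u l) z := by
  rw [moveReduces_iff]
  refine .inl ⟨.inr (posPart_rowMove_le h (negPart_nonneg z) ?_), ?_⟩
  · rw [Pi.negPart_apply]; exact hz.trans (neg_le_negPart _)
  · refine l1Norm_add_lt {k} ?_ ?_
    · intro m hm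
      rw [mem_singleton.1 hm, rowMove_of_lt u h.1]
      exact abs_add_of_le_neg (by positivity) hz
    · simp only [sum_abs_rowMove, sum_singleton, rowMove_of_lt u h.1, Nat.abs_cast, h.sum_Iic]
      have := h.2.2
      exact_mod_cast (by omega)

lemma moveReduces_of_sum_lt {i j : Fin n} {z : Fin n → ℤ} (hij : i < j)
    (h : ∑ k ∈ Iic j, u j k < 2 * (u j i + u j j)) (hi : (u j i : ℤ) ≤ -z i)
    (hj : (u j j : ℤ) ≤ z j) : MoveReduces (rowMove u j) z := by
  rw [moveReduces_iff]
  refine .inl ⟨.inl (negPart_rowMove_le u (posPart_nonneg z) ?_), ?_⟩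
  · rw [Pi.posPart_apply]; exact hj.trans (le_posPart _)
  · refine l1Norm_add_lt {i, j} ?_ ?_
    · intro m hm
      rcases mem_insert.1 hm with rfl | hm
      · rw [rowMove_of_lt u hij]
        exact abs_add_of_le_neg (by positivity) hi
      · rw [mem_singleton.1 hm, rowMove_self]
        exact abs_sub_of_le (by positivity) hj
    · rw [sum_pair hij.ne, sum_abs_rowMove, rowMove_of_lt u hij, rowMove_self, abs_neg,
        Nat.abs_cast, Nat.abs_cast]
      exact_mod_cast h

end Rows

section Lattice

variable {n : ℕ}

/-- The class modulo `L` of an exponent vector. -/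
noncomputable def exponentClass (L : AddSubgroup (Fin n → ℤ)) : (Fin n →₀ ℕ) →+ (Fin n → ℤ) ⧸ L :=
  (QuotientAddGroup.mk' L).comp
    { toFun := fun s i => (s i : ℤ)
      map_zero' := by ext; simp
      map_add' := fun s t => by ext; simp }

lemma exponentClass_posExp_eq_iff (L : AddSubgroup (Fin n → ℤ)) (v : Fin n → ℤ) :
    exponentClass L (posExp (-v)) = exponentClass L (posExp v) ↔ v ∈ L := by
  change QuotientAddGroup.mk' L (fun i => ((posExp (-v)) i : ℤ)) =
    QuotientAddGroup.mk' L (fun i => ((posExp v) i : ℤ)) ↔ _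
  rw [QuotientAddGroup.mk'_apply, QuotientAddGroup.mk'_apply, QuotientAddGroup.eq]
  have : -(fun i => ((posExp (-v)) i : ℤ)) + (fun i => ((posExp v) i : ℤ)) = v := by
    ext i
    simp only [posExp, Pi.add_apply, Pi.neg_apply, Finsupp.coe_equivFunOnFinite_symm]
    omega
  rw [this]

/-- The map `K[x_1, …, x_n] → K[ℤ^n / L]` that sends a monomial to the class of its exponent. -/
noncomputable def gradingHom (K : Type*) [Field K] (L : AddSubgroup (Fin n → ℤ)) :
    MvPolynomial (Fin n) K →+* AddMonoidAlgebra K ((Fin n → ℤ) ⧸ L) :=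
  AddMonoidAlgebra.mapDomainRingHom K (exponentClass L)

lemma gradingHom_monomial (K : Type*) [Field K] (L : AddSubgroup (Fin n → ℤ)) (s : Fin n →₀ ℕ) :
    gradingHom K L (MvPolynomial.monomial s 1) =
      AddMonoidAlgebra.single (exponentClass L s) 1 :=
  AddMonoidAlgebra.mapDomain_single

lemma gradingHom_binomial_eq_zero_iff (K : Type*) [Field K] (L : AddSubgroup (Fin n → ℤ))
    (v : Fin n → ℤ) : gradingHom K L (binomial K v) = 0 ↔ v ∈ L := by
  rw [binomial, map_sub, gradingHom_monomial, gradingHom_monomial, sub_eq_zero,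
    AddMonoidAlgebra.single_left_inj one_ne_zero, eq_comm, exponentClass_posExp_eq_iff]

lemma IsMarkovBasis.kerSet_subset_closure {K : Type*} [Field K] {a : Fin n → ℕ}
    {M : Set (Fin n → ℤ)} (hM : IsMarkovBasis K a M) :
    kerSet a ⊆ AddSubgroup.closure M := by
  intro v hv
  rw [SetLike.mem_coe, ← gradingHom_binomial_eq_zero_iff K, ← RingHom.mem_ker]
  have h1 : Ideal.span (binomial K '' M) ≤ RingHom.ker (gradingHom K (AddSubgroup.closure M)) := by
    rw [Ideal.span_le]
    rintro _ ⟨w, hw, rfl⟩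
    exact (gradingHom_binomial_eq_zero_iff K _ w).2 (AddSubgroup.subset_closure hw)
  exact h1 (hM.2 ▸ Ideal.subset_span ⟨v, hv, rfl⟩)

lemma IsMinimalMarkovBasis.zero_notMem {K : Type*} [Field K] {a : Fin n → ℕ}
    {M : Set (Fin n → ℤ)} (hM : IsMinimalMarkovBasis K a M) : (0 : Fin n → ℤ) ∉ M := by
  intro h0
  refine hM.2 (M \ {0}) ⟨Set.sdiff_subset, fun h => (h h0).2 rfl⟩
    ⟨Set.sdiff_subset.trans hM.1.1, ?_⟩
  rw [← hM.1.2]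
  refine le_antisymm (Ideal.span_mono (Set.image_mono Set.sdiff_subset)) (Ideal.span_le.2 ?_)
  rintro _ ⟨w, hw, rfl⟩
  by_cases hw0 : w = 0
  · rw [hw0, binomial, neg_zero, sub_self]; exact zero_mem _
  · exact Ideal.subset_span ⟨w, ⟨hw, hw0⟩, rfl⟩

variable {a : Fin n → ℕ} {M : Set (Fin n → ℤ)} {u : Fin n → Fin n → ℕ}

lemma neg_mem_kerSet {v : Fin n → ℤ} (hv : v ∈ kerSet a) : -v ∈ kerSet a := by
  have h : ∑ i, (a i : ℤ) * v i = 0 := hv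
  simp [kerSet, h]

lemma IsTriangularForm.rowMove_mem_kerSet (hu : IsTriangularForm M u) (hM : M ⊆ kerSet a)
    {k : Fin n} (hk : 0 < k.val) : rowMove u k ∈ kerSet a := by
  rcases hu.1 k hk with h | h
  · exact hM h
  · rw [← neg_neg (rowMove u k)]; exact neg_mem_kerSet (hM h)

lemma IsTriangularForm.diag_pos {K : Type*} [Field K] (ha : ∀ i, 0 < a i)
    (hM : IsMinimalMarkovBasis K a M) (hu : IsTriangularForm M u) {k : Fin n} (hk : 0 < k.val) :
    0 < u k k := by
  by_contra h0
  have h0 : u k k = 0 := by omega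
  have hnn (m : Fin n) : 0 ≤ rowMove u k m := by
    rcases lt_trichotomy m k with h | rfl | h
    · rw [rowMove_of_lt u h]; positivity
    · rw [rowMove_self, h0]; simp
    · rw [rowMove_of_gt u h]
  have hker : ∑ i, (a i : ℤ) * rowMove u k i = 0 := hu.rowMove_mem_kerSet hM.1.1 hk
  have hz : rowMove u k = 0 := by
    ext m
    have h1 := (sum_eq_zero_iff_of_nonneg
      (fun i _ => mul_nonneg (Int.natCast_nonneg (a i)) (hnn i))).1 hker m (mem_univ m)
    exact (mul_eq_zero.1 h1).resolve_left (by exact_mod_cast (ha m).ne')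
  rcases hu.1 k hk with h | h
  · exact hM.zero_notMem (hz ▸ h)
  · rw [hz, neg_zero] at h; exact hM.zero_notMem h

lemma IsTriangularForm.exists_coeff (hu : IsTriangularForm M u) {z : Fin n → ℤ}
    (hz : z ∈ AddSubgroup.closure M) :
    ∃ b : Fin n → ℤ, (∀ k : Fin n, k.val = 0 → b k = 0) ∧ z + ∑ k, b k • rowMove u k = 0 := by
  induction hz using AddSubgroup.closure_induction with
  | mem v hv =>
    obtain ⟨k, hk, h⟩ := hu.2 v hv
    rcases h with rfl | rfl
    · refine ⟨-Pi.single k 1, fun l hl => ?_, ?_⟩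
      · have : l ≠ k := by rintro rfl; omega
        simp [this]
      · simp [Pi.single_apply, ite_smul]
    · refine ⟨Pi.single k 1, fun l hl => ?_, ?_⟩
      · have : l ≠ k := by rintro rfl; omega
        simp [this]
      · simp [Pi.single_apply, ite_smul]
  | zero => exact ⟨0, by simp, by simp⟩
  | add x y _ _ hx hy =>
    obtain ⟨b, hb, h⟩ := hx
    obtain ⟨c, hc, h'⟩ := hy
    refine ⟨b + c, fun k hk => by simp [hb k hk, hc k hk], ?_⟩
    simp only [Pi.add_apply, add_smul, sum_add_distrib]
    rw [add_add_add_comm, h, h', add_zero]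
  | neg x _ hx =>
    obtain ⟨b, hb, h⟩ := hx
    refine ⟨-b, fun k hk => by simp [hb k hk], ?_⟩
    simp only [Pi.neg_apply, neg_smul, sum_neg_distrib]
    rw [← neg_add, h, neg_zero]

end Lattice

section Reduction

variable {n : ℕ} {u : Fin n → Fin n → ℕ}

lemma condR_iff (i j : Fin n) :
    CondR u i j ↔ (∑ k ∈ Iio i, u i k < u i i) ∨ (∃ l < j, IsChild u l i) ∨
      (∑ k ∈ Iic j, u j k < 2 * (u j i + u j j)) := by
  rw [CondR]
  refine or_congr Iff.rfl (or_congr (exists_congr fun l => ?_) Iff.rfl)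
  rw [IsChild]; tauto

lemma apply_add_sum_coeff {z b : Fin n → ℤ} (h : z + ∑ k, b k • rowMove u k = 0) (m : Fin n) :
    z m + ∑ l ∈ Ioi m, b l * u l m = b m * u m m := by
  have h1 := congrFun h m
  simp only [Pi.add_apply, Finset.sum_apply, Pi.smul_apply, smul_eq_mul, Pi.zero_apply] at h1
  have h2 : ∑ k, b k * rowMove u k m = ∑ l ∈ Ici m, b l * rowMove u l m := by
    refine (sum_subset (subset_univ _) fun k _ hk => ?_).symm
    rw [rowMove_of_gt u (by simpa using hk), mul_zero]
  rw [h2, ← Ioi_insert, sum_insert (by simp), rowMove_self,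
    sum_congr rfl fun l hl => by rw [rowMove_of_lt u (mem_Ioi.1 hl)]] at h1
  linarith

/-- An element of the lattice whose top coefficient is positive is reduced by a row, once every
index below the top one is contracting, or has a child below the top one, or satisfies the last
alternative of `CondR`. -/
lemma exists_moveReduces_of_coeff_pos {z b : Fin n → ℤ}
    (hb : z + ∑ k, b k • rowMove u k = 0) {j : Fin n} (hj0 : 0 < j.val) (hbj : 0 < b j)
    (htop : ∀ l, j < l → b l = 0) (hb0 : ∀ k : Fin n, k.val = 0 → b k = 0)
    (hR : ∀ i < j, (0 < i.val ∧ ∑ k ∈ Iio i, u i k < u i i) ∨ (∃ l < j, IsChild u l i) ∨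
      (∑ k ∈ Iic j, u j k < 2 * (u j i + u j j))) :
    ∃ k : Fin n, 0 < k.val ∧ MoveReduces (rowMove u k) z := by
  by_contra! hirr
  have hcoef := apply_add_sum_coeff hb
  have hzj : (u j j : ℤ) ≤ z j := by
    have h1 := hcoef j
    rw [sum_eq_zero fun l hl => by rw [htop l (mem_Ioi.1 hl), zero_mul], add_zero] at h1
    rw [h1]
    nlinarith [Int.natCast_nonneg (u j j)]
  have key : ∀ d : ℕ, ∀ m : Fin n, m < j → j.val - m.val = d →
      0 ≤ b m ∧ (¬ (0 < m.val ∧ ∑ k ∈ Iio m, u m k < u m m) → 0 < b m * u m m) := by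
    intro d
    induction d using Nat.strong_induction_on with
    | _ d ih =>
    intro m hm hd
    have hnn : ∀ l ∈ Ioi m, 0 ≤ b l * (u l m : ℤ) := by
      intro l hl
      refine mul_nonneg ?_ (Int.natCast_nonneg _)
      rcases lt_trichotomy l j with h | rfl | h
      · exact (ih (j.val - l.val) (by have := mem_Ioi.1 hl; omega) l h rfl).1
      · exact hbj.le
      · exact (htop l h).ge
    have hge : ∀ l, m < l → z m + b l * (u l m : ℤ) ≤ b m * u m m := by
      intro l hl
      have := single_le_sum hnn (mem_Ioi.2 hl)
      linarith [hcoef m]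
    by_cases hc : 0 < m.val ∧ ∑ k ∈ Iio m, u m k < u m m
    · refine ⟨?_, fun h => absurd hc h⟩
      have h1 : -z m < u m m := by
        by_contra! h
        exact hirr m hc.1 (moveReduces_of_contracting hc.2 h)
      have h2 := hcoef m
      have h3 := sum_nonneg hnn
      by_contra! h
      nlinarith [Int.natCast_nonneg (u m m)]
    · have hpos' : 0 < b m * u m m := by
        rcases (hR m hm).resolve_left hc with ⟨l, hl, hch⟩ | hs
        · have hml := hch.1
          have hl0 : 0 < l.val := by omega
          have h1 : -z m < u l m := by
            by_contra! h
            exact hirr l hl0 (moveReduces_of_isChild hch h)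
          have hnc : ¬ (0 < l.val ∧ ∑ k ∈ Iio l, u l k < u l l) := by
            rintro ⟨-, h⟩
            have h4 := hch.sum_Iic
            have h5 := hch.2.2
            rw [sum_Iic_eq] at h4
            omega
          have h2 := (ih (j.val - l.val) (by omega) l hl rfl).2 hnc
          have h3 : 0 < b l := pos_of_mul_pos_left h2 (Int.natCast_nonneg _)
          have := hge l hml
          nlinarith [Int.natCast_nonneg (u l m)]
        · have h1 : -z m < u j m := by
            by_contra! h
            exact hirr j hj0 (moveReduces_of_sum_lt hm hs h hzj)
          have := hge j hm
          nlinarith [Int.natCast_nonneg (u j m)]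
      exact ⟨(pos_of_mul_pos_left hpos' (Int.natCast_nonneg _)).le, fun _ => hpos'⟩
  have h0 : (⟨0, by omega⟩ : Fin n) < j := hj0
  have h1 := (key _ ⟨0, by omega⟩ h0 rfl).2 (by simp)
  rw [hb0 _ rfl, zero_mul] at h1
  exact lt_irrefl _ h1

lemma exists_moveReduces {z b : Fin n → ℤ}
    (hb : z + ∑ k, b k • rowMove u k = 0) (hb0 : ∀ k : Fin n, k.val = 0 → b k = 0) (hz : z ≠ 0)
    (hR : ∀ i j : Fin n, i < j → (0 < i.val ∧ ∑ k ∈ Iio i, u i k < u i i) ∨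
      (∃ l < j, IsChild u l i) ∨ (∑ k ∈ Iic j, u j k < 2 * (u j i + u j j))) :
    ∃ k : Fin n, 0 < k.val ∧ MoveReduces (rowMove u k) z := by
  have hne : (univ.filter fun k => b k ≠ 0).Nonempty := by
    by_contra h
    rw [not_nonempty_iff_eq_empty, filter_eq_empty_iff] at h
    refine hz ?_
    rw [← hb, sum_eq_zero fun k hk => by rw [not_not.1 (h hk), zero_smul], add_zero]
  obtain ⟨j, hj, hmax⟩ := exists_max_image _ id hne
  simp only [mem_filter, mem_univ, true_and, id] at hj hmax
  have htop : ∀ l, j < l → b l = 0 := fun l hl => by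
    by_contra h
    exact absurd (hmax l h) hl.not_ge
  have hj0 : 0 < j.val := by
    by_contra h
    exact hj (hb0 j (by omega))
  rcases lt_or_gt_of_ne hj with h | h
  · obtain ⟨k, hk, hred⟩ := exists_moveReduces_of_coeff_pos (z := -z) (b := -b)
      (by simp only [Pi.neg_apply, neg_smul, sum_neg_distrib, ← neg_add, hb, neg_zero])
      hj0 (by simpa using h) (fun l hl => by simp [htop l hl]) (fun k hk => by simp [hb0 k hk])
      (fun i hi => hR i j hi)
    exact ⟨k, hk, (moveReduces_neg_right _ _).1 hred⟩
  · exact exists_moveReduces_of_coeff_pos hb hj0 h htop hb0 (fun i hi => hR i j hi)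

end Reduction

section Circuits

variable {n : ℕ} {a : Fin n → ℕ}

lemma exists_circuit (ha : ∀ i, 0 < a i) {p q : Fin n} (hpq : p ≠ q) :
    ∃ z ∈ circuits a, 0 < z p ∧ z q < 0 ∧ ∀ m, m ≠ p → m ≠ q → z m = 0 := by
  obtain ⟨g, x, y, hg, hco, hx, hy⟩ := Nat.exists_coprime' (Nat.gcd_pos_of_pos_left (a q) (ha p))
  have hx0 : 0 < x := Nat.pos_of_mul_pos_right (hx ▸ ha p)
  have hy0 : 0 < y := Nat.pos_of_mul_pos_right (hy ▸ ha q)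
  let z : Fin n → ℤ := fun m => if m = p then y else if m = q then -x else 0
  have hzp : z p = y := by simp [z]
  have hzq : z q = -x := by simp [z, hpq.symm]
  have hz0 : ∀ m, m ≠ p → m ≠ q → z m = 0 := fun m h1 h2 => by simp [z, h1, h2]
  refine ⟨z, ⟨?_, ?_, ?_⟩, by rw [hzp]; exact_mod_cast hy0, by rw [hzq]; omega, hz0⟩
  · change ∑ i, (a i : ℤ) * z i = 0
    rw [← sum_subset (subset_univ {p, q}), sum_pair hpq, hzp, hzq, hx, hy]
    · push_cast; ring
    · intro m _ hm
      simp only [mem_insert, mem_singleton, not_or] at hm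
      rw [hz0 m hm.1 hm.2, mul_zero]
  · rw [show (univ.filter fun i => z i ≠ 0) = {p, q} from ?_, card_pair hpq]
    ext m
    simp only [mem_filter, mem_univ, true_and, mem_insert, mem_singleton]
    constructor
    · intro h
      by_contra! h'
      exact h (hz0 m h'.1 h'.2)
    · rintro (rfl | rfl)
      · rw [hzp]; exact_mod_cast hy0.ne'
      · rw [hzq]; omega
  · have h1 : univ.gcd z ∣ (y : ℤ) := hzp ▸ gcd_dvd (mem_univ p)
    have h2 : univ.gcd z ∣ (x : ℤ) := by
      rw [← dvd_neg, ← hzq]; exact gcd_dvd (mem_univ q)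
    have h3 : IsUnit (univ.gcd z) :=
      (Nat.isCoprime_iff_coprime.2 hco).isUnit_of_dvd' h2 h1
    rw [← Finset.normalize_gcd, normalize_eq_one]
    exact h3

variable {u : Fin n → Fin n → ℕ}

/-- The columns that are reached from `i` by passing repeatedly to a child. -/
def IsDescendant (u : Fin n → Fin n → ℕ) (i p : Fin n) : Prop :=
  Relation.ReflTransGen (fun x y => IsChild u y x) i p

lemma IsDescendant.le {i p : Fin n} (h : IsDescendant u i p) : i ≤ p := by
  induction h with
  | refl => exact le_rfl
  | tail _ hc ih => exact ih.trans hc.1.le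

lemma exists_childless_descendant (u : Fin n → Fin n → ℕ) (i : Fin n) :
    ∃ p, IsDescendant u i p ∧ ∀ t, ¬ IsChild u t p := by
  induction i using WellFoundedGT.induction with
  | _ i ih =>
  by_cases h : ∃ t, IsChild u t i
  · obtain ⟨t, ht⟩ := h
    obtain ⟨p, hp, hp'⟩ := ih t ht.1
    exact ⟨p, Relation.ReflTransGen.head ht hp, hp'⟩
  · exact ⟨i, Relation.ReflTransGen.refl, not_exists.1 h⟩

lemma IsDescendant.eq_or_lt_of_not_condR {i j p : Fin n} (hjj : 0 < u j j) (hR : ¬ CondR u i j)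
    (hp : IsDescendant u i p) : p = i ∨ j < p := by
  rw [condR_iff, not_or, not_or] at hR
  rcases Relation.ReflTransGen.cases_head hp with rfl | ⟨c, hc, hcp⟩
  · exact .inl rfl
  · right
    have h1 : ¬ c < j := fun h => hR.2.1 ⟨c, h, hc⟩
    have h2 : c ≠ j := by
      rintro rfl
      refine hR.2.2 ?_
      rw [hc.sum_Iic]
      omega
    exact (lt_of_le_of_ne (not_lt.1 h1) h2.symm).trans_le (IsDescendant.le hcp)

lemma IsDescendant.disjoint_of_not_condR {i j p : Fin n} (hij : i < j) (hjj : 0 < u j j)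
    (hR : ¬ CondR u i j) (hp : IsDescendant u i p) : ¬ IsDescendant u j p := by
  induction hp with
  | refl => exact fun h => absurd h.le hij.not_ge
  | @tail p' p hp' hc ih =>
    intro h
    rcases Relation.ReflTransGen.cases_tail h with rfl | ⟨p'', hp'', hc''⟩
    · rcases IsDescendant.eq_or_lt_of_not_condR hjj hR (hp'.tail hc) with h | h
      · exact hij.ne' h
      · exact lt_irrefl _ h
    · exact ih (hc.parent_unique hc'' ▸ hp'')

lemma le_sum_Iic {t s : Fin n} (h : s < t) : u t s + u t t ≤ ∑ m ∈ Iic t, u t m := by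
  rw [sum_Iic_eq]
  have := single_le_sum (f := u t) (fun _ _ => Nat.zero_le _) (mem_Iio.2 h)
  omega

lemma IsChild.two_mul_abs_add_le {t p q : Fin n} (h : IsChild u t p) (hqp : q ≠ p)
    (hqt : q ≠ t) : 2 * (|rowMove u t t| + |rowMove u t q|) ≤ ∑ m, |rowMove u t m| := by
  have h0 : rowMove u t q = 0 := by
    rcases lt_or_gt_of_ne hqt with h' | h'
    · rw [rowMove_of_lt u h', h.2.1 q h' hqp, Nat.cast_zero]
    · exact rowMove_of_gt u h'
  rw [sum_abs_rowMove, h.sum_Iic, h0, rowMove_self, abs_neg, Nat.abs_cast, abs_zero, add_zero]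
  have := h.2.2
  exact_mod_cast (by omega)

/-- A row `t` off the support `{p, q}` of `z` that is applicable to `z⁺` or `z⁻` has, apart from
the entry `t`, only the entry `p` or only the entry `q`; if these have no child,
it does not reduce the distance of `z`. -/
lemma not_moveReduces_of_notMem_support {z : Fin n → ℤ} {p q t : Fin n} (hpq : p ≠ q)
    (hzp : 0 < z p) (hzq : z q < 0) (hz : ∀ m, m ≠ p → m ≠ q → z m = 0)
    (hp : ¬ IsChild u t p) (hq : ¬ IsChild u t q) (htt : 0 < u t t) (htp : t ≠ p) (htq : t ≠ q) :
    ¬ MoveReduces (rowMove u t) z := by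
  have hzt := hz t htp htq
  have hle : ∀ v : Fin n → ℤ, 2 * ∑ m ∈ {p, q}, |v m| ≤ ∑ m, |v m| →
      l1Norm z ≤ l1Norm (z + v) := by
    refine fun v h => l1Norm_le_add {p, q} (fun m hm => ?_) h
    simp only [mem_insert, mem_singleton, not_or] at hm
    exact hz m hm.1 hm.2
  have hneg : ∀ w : Fin n → ℤ, w t = 0 → ¬ (rowMove u t)⁻ ≤ w := by
    intro w hw h
    have h1 : (rowMove u t)⁻ t ≤ w t := h t
    rw [Pi.negPart_apply, rowMove_self, negPart_neg, posPart_of_nonneg (by positivity), hw] at h1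
    omega
  have hpure : ∀ s s' : Fin n, s ≠ s' → ({p, q} : Finset (Fin n)) = {s, s'} → ¬ IsChild u t s →
      ∀ w : Fin n → ℤ, (∀ m, m ≠ s → w m = 0) → (rowMove u t)⁺ ≤ w →
      2 * ∑ m ∈ {p, q}, |rowMove u t m| ≤ ∑ m, |rowMove u t m| := by
    intro s s' hss hpair hs w hw h
    have h0 : ∀ m < t, m ≠ s → u t m = 0 := by
      intro m hm hms
      have h1 : (rowMove u t)⁺ m ≤ w m := h m
      rw [Pi.posPart_apply, rowMove_of_lt u hm, posPart_of_nonneg (by positivity), hw m hms] at h1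
      omega
    have hts' : t ≠ s' := by
      have : s' ∈ ({p, q} : Finset (Fin n)) := by rw [hpair]; simp
      rcases mem_insert.1 this with rfl | h
      · exact htp
      · rw [mem_singleton.1 h]; exact htq
    have hts : t ≠ s := by
      have : s ∈ ({p, q} : Finset (Fin n)) := by rw [hpair]; simp
      rcases mem_insert.1 this with rfl | h
      · exact htp
      · rw [mem_singleton.1 h]; exact htq
    have hs' : rowMove u t s' = 0 := by
      rcases lt_or_gt_of_ne hts' with h' | h'
      · exact rowMove_of_gt u h'
      · rw [rowMove_of_lt u h', h0 s' h' hss.symm, Nat.cast_zero]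
    rw [hpair, sum_pair hss, hs', abs_zero, add_zero, sum_abs_rowMove]
    rcases lt_or_gt_of_ne hts with h' | h'
    · rw [rowMove_of_gt u h', abs_zero, mul_zero]; positivity
    · rw [rowMove_of_lt u h', Nat.abs_cast]
      have h2 : ¬ u t t < u t s := fun h3 => hs ⟨h', h0, h3⟩
      have h3 := le_sum_Iic (u := u) h'
      exact_mod_cast (by omega)
  have hnorm : (rowMove u t)⁺ ≤ z⁺ ∨ (rowMove u t)⁺ ≤ z⁻ →
      2 * ∑ m ∈ {p, q}, |rowMove u t m| ≤ ∑ m, |rowMove u t m| := by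
    rintro (h | h)
    · refine hpure p q hpq rfl hp z⁺ (fun m hm => ?_) h
      rw [Pi.posPart_apply, posPart_eq_zero]
      by_cases hmq : m = q
      · rw [hmq]; exact hzq.le
      · exact (hz m hm hmq).le
    · refine hpure q p hpq.symm (pair_comm p q) hq z⁻ (fun m hm => ?_) h
      rw [Pi.negPart_apply, negPart_eq_zero]
      by_cases hmp : m = p
      · rw [hmp]; exact hzp.le
      · exact (hz m hmp hm).ge
  have hz1 : z⁺ t = 0 := by rw [Pi.posPart_apply, hzt, posPart_zero]
  have hz2 : z⁻ t = 0 := by rw [Pi.negPart_apply, hzt, negPart_zero]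
  rw [moveReduces_iff]
  rintro (⟨h | h, hlt⟩ | ⟨h | h, hlt⟩)
  · exact hneg _ hz1 h
  · exact hlt.not_ge (hle _ (hnorm (.inr h)))
  · rw [sub_eq_add_neg] at hlt
    exact hlt.not_ge (hle _ (by simpa using hnorm (.inl h)))
  · exact hneg _ hz2 h

lemma condR_of_reducesDistance_circuits (ha : ∀ i, 0 < a i) {M : Set (Fin n → ℤ)}
    (hu : IsTriangularForm M u) (hpos : ∀ k : Fin n, 0 < k.val → 0 < u k k)
    (hred : ReducesDistance M (circuits a)) {i j : Fin n} (hi : 0 < i.val) (hij : i < j) :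
    CondR u i j := by
  by_contra hR
  have hjj : 0 < u j j := hpos j (by omega)
  obtain ⟨p, hp, hpc⟩ := exists_childless_descendant u i
  obtain ⟨q, hq, hqc⟩ := exists_childless_descendant u j
  have hdisj : ∀ x, IsDescendant u i x → IsDescendant u j x → False :=
    fun x => IsDescendant.disjoint_of_not_condR hij hjj hR
  have hpq : p ≠ q := by rintro rfl; exact hdisj p hp hq
  have hpi := IsDescendant.eq_or_lt_of_not_condR hjj hR hp
  obtain ⟨z, hzc, hzp, hzq, hz⟩ := exists_circuit ha hpq
  obtain ⟨v, hv, hvred⟩ := hred z hzc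
  obtain ⟨t, ht, hvt⟩ := hu.2 v hv
  have hred' : MoveReduces (rowMove u t) z := by
    rcases hvt with rfl | rfl
    · exact hvred
    · exact (moveReduces_neg_left _ _).1 hvred
  have hle : ∀ v : Fin n → ℤ, 2 * ∑ m ∈ {p, q}, |v m| ≤ ∑ m, |v m| →
      l1Norm z ≤ l1Norm (z + v) := by
    refine fun v h => l1Norm_le_add {p, q} (fun m hm => ?_) h
    simp only [mem_insert, mem_singleton, not_or] at hm
    exact hz m hm.1 hm.2
  have hfalse : ¬ 2 * ∑ m ∈ {p, q}, |rowMove u t m| ≤ ∑ m, |rowMove u t m| := by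
    intro h
    rw [moveReduces_iff] at hred'
    rcases hred' with ⟨-, hlt⟩ | ⟨-, hlt⟩
    · exact hlt.not_ge (hle _ h)
    · rw [sub_eq_add_neg] at hlt
      exact hlt.not_ge (hle _ (by simpa using h))
  rw [sum_pair hpq] at hfalse
  have hR' := hR
  rw [condR_iff, not_or, not_or, not_lt, not_lt] at hR'
  by_cases htp : t = p
  · subst htp
    rcases Relation.ReflTransGen.cases_tail hp with h | ⟨p', hp', hc⟩
    · subst h
      have hjq : j ≤ q := IsDescendant.le hq
      refine hfalse ?_
      rw [rowMove_of_gt u (hij.trans_le hjq), rowMove_self, abs_neg, Nat.abs_cast, abs_zero,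
        add_zero, sum_abs_rowMove, sum_Iic_eq]
      have := hR'.1
      exact_mod_cast (by omega)
    · exact hfalse (hc.two_mul_abs_add_le (fun h => hdisj q (h ▸ hp') hq) hpq.symm)
  · by_cases htq : t = q
    · subst htq
      rcases Relation.ReflTransGen.cases_tail hq with h | ⟨q', hq', hc⟩
      · subst h
        refine hfalse ?_
        rw [rowMove_self, abs_neg, Nat.abs_cast, sum_abs_rowMove]
        have h2 := hR'.2.2
        rcases hpi with rfl | hjp
        · rw [rowMove_of_lt u hij, Nat.abs_cast]
          exact_mod_cast h2
        · rw [rowMove_of_gt u hjp, abs_zero]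
          exact_mod_cast (by omega)
      · have := hc.two_mul_abs_add_le (q := p) (fun h => hdisj p hp (h ▸ hq')) hpq
        rw [add_comm] at this
        exact hfalse this
    · exact not_moveReduces_of_notMem_support hpq hzp hzq hz (hpc t) (hqc t) (hpos t ht) htp htq
        hred'

lemma isDistanceReducing_of_condR {K : Type*} [Field K] (ha : ∀ i, 0 < a i)
    (h12 : ∀ i j : Fin n, i.val = 0 → j.val = 1 → a i < a j)
    {M : Set (Fin n → ℤ)} (hM : IsMinimalMarkovBasis K a M) (hu : IsTriangularForm M u)
    (hR : ∀ i j : Fin n, 0 < i.val → i < j → CondR u i j) : IsDistanceReducing a M := by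
  rintro z ⟨hz, hz0⟩
  obtain ⟨b, hb0, hb⟩ := hu.exists_coeff (hM.1.kerSet_subset_closure hz)
  have hfirst : ∀ i l : Fin n, i.val = 0 → l.val = 1 → IsChild u l i := by
    intro i l hi hl
    have hil : i < l := by rw [Fin.lt_def]; omega
    have hIio : Iio l = {i} := by
      ext m
      simp only [mem_Iio, mem_singleton, Fin.lt_def, Fin.ext_iff]
      omega
    refine ⟨hil, fun m hm hmi => absurd (Fin.ext (by rw [Fin.lt_def] at hm; omega)) hmi, ?_⟩
    have hker : ∑ k, (a k : ℤ) * rowMove u l k = 0 :=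
      hu.rowMove_mem_kerSet hM.1.1 (by omega)
    have hsub : ∑ k ∈ {i, l}, (a k : ℤ) * rowMove u l k = 0 := by
      rw [← hker]
      refine sum_subset (subset_univ _) fun m _ hm => ?_
      simp only [mem_insert, mem_singleton, not_or, Fin.ext_iff] at hm
      rw [rowMove_of_gt u (by rw [Fin.lt_def]; omega), mul_zero]
    rw [sum_pair hil.ne, rowMove_of_lt u hil, rowMove_self] at hsub
    have h1 : a i * u l i = a l * u l l := by zify; linarith
    have h2 := h12 i l hi hl
    have h3 : 0 < u l l := hu.diag_pos ha hM (by omega)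
    by_contra! h
    nlinarith [Nat.mul_le_mul_left (a i) h]
  obtain ⟨k, hk, hred⟩ := exists_moveReduces hb hb0 hz0 fun i j hij => by
    by_cases hi : 0 < i.val
    · rcases (condR_iff i j).1 (hR i j hi hij) with h | h | h
      · exact .inl ⟨hi, h⟩
      · exact .inr (.inl h)
      · exact .inr (.inr h)
    · right
      by_cases hj : j.val = 1
      · right
        have hc := hfirst i j (by omega) hj
        have : 0 < u j j := hu.diag_pos ha hM (by omega)
        rw [hc.sum_Iic]
        omega
      · left
        have hlt : 1 < j.val := by rw [Fin.lt_def] at hij; omega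
        exact ⟨⟨1, by omega⟩, hlt, hfirst i ⟨1, by omega⟩ (by omega) rfl⟩
  rcases hu.1 k hk with h | h
  · exact ⟨_, h, hred⟩
  · exact ⟨_, h, (moveReduces_neg_left _ _).2 hred⟩

lemma circuits_subset : circuits a ⊆ {z | z ∈ kerSet a ∧ z ≠ 0} := by
  rintro z ⟨hz, hcard, -⟩
  refine ⟨hz, ?_⟩
  rintro rfl
  simp at hcard

end Circuits

theorem mainTheorem3 (K : Type*) [Field K] (n : ℕ) (a : Fin n → ℕ)
    (ha : ∀ i, 0 < a i) (hfirst : IsFirstKind a)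
    (h12 : ∀ i j : Fin n, i.val = 0 → j.val = 1 → a i < a j)
    (M : Set (Fin n → ℤ)) (hM : IsMinimalMarkovBasis K a M)
    (u : Fin n → Fin n → ℕ) (hu : IsTriangularForm M u) :
    List.TFAE [
      IsDistanceReducing a M,
      ReducesDistance M (circuits a),
      ∀ i j : Fin n, 0 < i.val → i < j → CondR u i j] := by
  tfae_have 1 → 2 := fun h z hz => h z (circuits_subset hz)
  tfae_have 2 → 3 := fun h i j hi hij =>
    condR_of_reducesDistance_circuits ha hu (fun _ hk => hu.diag_pos ha hM hk) h hi hij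
  tfae_have 3 → 1 := fun h => isDistanceReducing_of_condR ha h12 hM hu h
  tfae_finish
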